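/- Let $\Omega \subset \mathbb{C}$ be a simply connected open set with $0 \notin \Omega$, $0 \in \overline{\Omega}$, that is star-shaped around $0$: $ta \in \Omega$ for all $a \in \Omega$ and $t \in (0,1]$. For $\sigma \in \mathbb{R}$, let $E^{\sigma}(\Omega)$ be the space of holomorphic functions $f$ on $\Omega$ for which there are $\Lambda, M \in \mathbb{R}$ with $|f(\zeta)| \le M\,|\zeta|^{\sigma} e^{\Lambda|\zeta|}$ for all $\zeta \in \Omega$. Let $p, q$ be holomorphic functions on $\Omega$, with $p$ nowhere zero on $\Omega$, let $k_0(a,a') = -q(a')/p(a)$, and let $k_\star$ be a holomorphic function on $\Omega^2$. Put $\mathcal{V} = \mathcal{V}_0 + \mathcal{V}_\star$, where $$[\mathcal{V}_0\varphi](a) = \int_0^a k_0(a,a')\,\varphi(a')\,da', \qquad [\mathcal{V}_\star\varphi](a) = \int_0^a k_\star(a,a')\,\varphi(a')\,da' \qquad (a \in \Omega)$$ are integrals along the straight path from $0$ to $a$. Suppose that there are real constants $\tau > 0$, $\gamma > 0$, $\lambda_\Delta$, $\epsilon > 0$ and a complex constant $B \neq 0$ such that: 1. $k_0(a,a) - \tau/a$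 is bounded for $a \in \Omega$ in some neighborhood of $0$, and for each $\sigma > \tau$ the bound $|k_0(a,a')| < \sigma/|a|$ holds for all $(a,a') \in \Omega^2$ in some neighborhood of $(0,0)$; 2. there is a constant $C$ with $|k_0(a,a')| \le \frac{C}{|a|}\, e^{\lambda_\Delta|a-a'|}$ for all $a,a' \in \Omega$; 3. there is a constant $C$ with $|k_\star(a,a')| \le C\,\frac{|a-a'|^{\gamma}}{|a|}\, e^{\lambda_\Delta|a-a'|}$ for all $a,a' \in \Omega$; 4. $p(\zeta) = B\zeta + O(|\zeta|^{1+\epsilon})$ as $\zeta \to 0$ in $\Omega$. Fix any holomorphic branch of $\log \zeta$ on $\Omega$ and let $\zeta^{\tau-1} = e^{(\tau-1)\log\zeta}$. Then, for each $\rho \in (\tau,\ \tau + \min\{\gamma,\epsilon,1\}]$, the affine space $\zeta^{\tau-1} + E^{\rho-1}(\Omega)$ is contained in $E^{\tau-1}(\Omega)$; the integrals defining $\mathcal{V}_0\varphi$ and $\mathcal{V}_\star\varphi$ converge absolutely at every point of $\Omega$ for every $\varphi \in E^{\tau-1}(\Omega)$; and the equation $f = \mathcal{V}f$ has a unique solution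 $f$ in $\zeta^{\tau-1} + E^{\rho-1}(\Omega)$. -/

import Mathlib

open Set Filter Topology MeasureTheory Asymptotics

namespace SingVolterra

noncomputable section

/-- The position domain: a simply connected open set that touches but does not contain `0` and is
star-shaped around `0`; the end point `0` is omitted from the straight paths. -/
structure IsDomain (Ω : Set ℂ) : Prop where
  isOpen : IsOpen Ω
  isSimplyConnected : IsSimplyConnected Ω
  zero_notMem : (0 : ℂ) ∉ Ω
  zero_mem_closure : (0 : ℂ) ∈ closure Ω
  star : ∀ a ∈ Ω, ∀ t ∈ Ioc (0 : ℝ) 1, (t : ℂ) * a ∈ Ω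

/-- The space of holomorphic functions `f` on `Ω` with `|f| ≲ |ζ|^σ e^{Λ|ζ|}` over `Ω`. Functions on
`Ω` are represented by functions on `ℂ`, of which only the values on `Ω` matter. -/
def SingExp (Ω : Set ℂ) (σ Λ : ℝ) : Set (ℂ → ℂ) :=
  {f | DifferentiableOn ℂ f Ω ∧
    ∃ M : ℝ, ∀ z ∈ Ω, ‖f z‖ ≤ M * (‖z‖ ^ σ * Real.exp (Λ * ‖z‖))}

/-- The union over all real `Λ` of the spaces `SingExp Ω σ Λ`. -/
def SingExpUnion (Ω : Set ℂ) (σ : ℝ) : Set (ℂ → ℂ) :=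
  ⋃ Λ : ℝ, SingExp Ω σ Λ

/-- `L` is a holomorphic branch of the logarithm on `Ω`. -/
def IsLogBranch (Ω : Set ℂ) (L : ℂ → ℂ) : Prop :=
  DifferentiableOn ℂ L Ω ∧ ∀ z ∈ Ω, Complex.exp (L z) = z

/-- The power function `ζ^s` given by the branch `L` of the logarithm. -/
def branchPow (L : ℂ → ℂ) (s : ℝ) (z : ℂ) : ℂ :=
  Complex.exp ((s : ℂ) * L z)

/-- The affine space `g + SingExpUnion Ω σ`. -/
def affineSingExp (Ω : Set ℂ) (g : ℂ → ℂ) (σ : ℝ) : Set (ℂ → ℂ) :=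
  {f | (fun z => f z - g z) ∈ SingExpUnion Ω σ}

/-- The integrand of the Volterra integral of `φ` with kernel `w`, from `0` to `a`, along the
straight path `t ↦ t a`. -/
def volterraIntegrand (w : ℂ → ℂ → ℂ) (φ : ℂ → ℂ) (a : ℂ) (t : ℝ) : ℂ :=
  w a ((t : ℂ) * a) * φ ((t : ℂ) * a) * a

/-- The Volterra integral from `0` to `a` converges absolutely. -/
def VolterraConverges (w : ℂ → ℂ → ℂ) (φ : ℂ → ℂ) (a : ℂ) : Prop :=
  IntervalIntegrable (volterraIntegrand w φ a) volume 0 1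

/-- The Volterra operator with kernel `w`. -/
def volterra (w : ℂ → ℂ → ℂ) (φ : ℂ → ℂ) (a : ℂ) : ℂ :=
  ∫ t in (0 : ℝ)..1, volterraIntegrand w φ a t

/-- The separable kernel `k₀(a, a') = - q(a') / p(a)`. -/
def sepKernel (p q : ℂ → ℂ) (a a' : ℂ) : ℂ :=
  -(q a' / p a)

/-- The kernel `w` is a holomorphic function on `Ω²`. -/
def IsHolomorphicKernel (Ω : Set ℂ) (w : ℂ → ℂ → ℂ) : Prop :=
  DifferentiableOn ℂ (fun x : ℂ × ℂ => w x.1 x.2) (Ω ×ˢ Ω)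

/-- The kernel has a regular singularity at `ζ = 0`, with constant `τ > 0`. -/
structure CondSing (Ω : Set ℂ) (k : ℂ → ℂ → ℂ) (τ : ℝ) : Prop where
  pos : 0 < τ
  diag : ∃ M : ℝ, ∀ᶠ a in 𝓝[Ω] (0 : ℂ), ‖k a a - (τ : ℂ) / a‖ ≤ M
  near : ∀ σ : ℝ, τ < σ →
    ∀ᶠ x in 𝓝[Ω ×ˢ Ω] ((0 : ℂ), (0 : ℂ)), ‖k x.1 x.2‖ < σ / ‖x.1‖

/-- `|k(a, a')| ≲ e^{lam |a - a'|} / |a|` over all `a, a' ∈ Ω`. -/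
def CondDiag (Ω : Set ℂ) (k : ℂ → ℂ → ℂ) (lam : ℝ) : Prop :=
  ∃ C : ℝ, ∀ a ∈ Ω, ∀ a' ∈ Ω,
    ‖k a a'‖ ≤ C * (1 / ‖a‖ * Real.exp (lam * ‖a - a'‖))

/-- `γ > 0` and `|k(a, a')| ≲ |a - a'|^γ e^{lam |a - a'|} / |a|` over all `a, a' ∈ Ω`. -/
structure CondDiagStar (Ω : Set ℂ) (k : ℂ → ℂ → ℂ) (γ lam : ℝ) : Prop where
  pos : 0 < γ
  bound : ∃ C : ℝ, ∀ a ∈ Ω, ∀ a' ∈ Ω,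
    ‖k a a'‖ ≤ C * (‖a - a'‖ ^ γ / ‖a‖ * Real.exp (lam * ‖a - a'‖))

/-- `B ≠ 0`, `ε > 0` and `p = B ζ + O(|ζ|^{1+ε})` at `ζ = 0` in `Ω`. -/
structure CondRegP (Ω : Set ℂ) (p : ℂ → ℂ) (B : ℂ) (ε : ℝ) : Prop where
  ne_zero : B ≠ 0
  pos : 0 < ε
  isBigO : (fun z => p z - B * z) =O[𝓝[Ω] (0 : ℂ)] (fun z => ‖z‖ ^ (1 + ε))

end

end SingVolterra

namespace SingVolterra

/-! Write `φ = ζ^(τ-1)` and `f = φ + g`. Then `f = 𝒱f` becomes `g = 𝒱g + h` with source `h = 𝒱φ -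
φ`, to be solved for `g` in `E^(ρ-1)`. Two facts settle it.

The source lies in `E^(ρ-1)`. Near `0` the kernel `k₀` is `τ/a` up to a relative error `O(|a|^β)`,
`β = ρ - τ`, and the kernel `τ/a` fixes `φ` exactly because `τ ∫₀¹ t^(τ-1) dt = 1`; see
`volterra_sepKernel_branchPow_sub_mem`. The operator `𝒱⋆` raises the exponent by `γ ≥ β`; see
`CondDiagStar.volterra_mem`.

On `E^(ρ-1)` with weight `|ζ|^(ρ-1) e^(Λ|ζ|)` and `Λ` large, `𝒱` is a contraction. Near `0`, for any
`σ > τ`, the factor is at most `σ ∫₀¹ t^(ρ-1) dt = σ/ρ`, which is below `1` when `σ < ρ`. Away from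
`0`, and for `𝒱⋆` everywhere, the exponential weight makes the factor as small as desired; see the
two lemmas `eventually_norm_volterra_le`. Picard iteration gives existence, and iterating the bound
on a difference of solutions gives uniqueness. -/

variable {Ω : Set ℂ} {p q : ℂ → ℂ} {w : ℂ → ℂ → ℂ} {f g : ℂ → ℂ} {L : ℂ → ℂ} {B : ℂ}
  {s σ σ' ρ τ γ lam Λ M θ κ β ε : ℝ} {a z : ℂ} {t : ℝ}

/-! ### Elementary estimates along rays and for kernels -/

theorem IsDomain.ne_zero (hΩ : IsDomain Ω) (ha : a ∈ Ω) : a ≠ 0 :=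
  fun h => hΩ.zero_notMem (h ▸ ha)

theorem IsDomain.norm_pos (hΩ : IsDomain Ω) (ha : a ∈ Ω) : 0 < ‖a‖ :=
  _root_.norm_pos_iff.2 (hΩ.ne_zero ha)

theorem norm_ofReal_mul (ht : 0 ≤ t) (a : ℂ) : ‖(t : ℂ) * a‖ = t * ‖a‖ := by
  rw [norm_mul, Complex.norm_real, Real.norm_of_nonneg ht]

theorem norm_sub_ofReal_mul (ht : t ≤ 1) (a : ℂ) : ‖a - (t : ℂ) * a‖ = (1 - t) * ‖a‖ := by
  have : a - (t : ℂ) * a = ((1 - t : ℝ) : ℂ) * a := by push_cast; ring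
  rw [this, norm_ofReal_mul (by linarith)]

theorem intervalIntegrable_rpow_zero_one (hσ : -1 < σ) (c : ℝ) :
    IntervalIntegrable (fun t : ℝ => t ^ σ * c) volume 0 1 :=
  (intervalIntegral.intervalIntegrable_rpow' hσ).mul_const c

theorem integral_rpow_zero_one (hσ : -1 < σ) (c : ℝ) :
    ∫ t in (0 : ℝ)..1, t ^ σ * c = c / (σ + 1) := by
  rw [intervalIntegral.integral_mul_const, integral_rpow (Or.inl hσ), Real.one_rpow,
    Real.zero_rpow (by linarith)]
  ring

theorem CondDiag.exists_nonneg (hw : CondDiag Ω w lam) :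
    ∃ C, 0 ≤ C ∧ ∀ a ∈ Ω, ∀ a' ∈ Ω,
      ‖w a a'‖ ≤ C * (1 / ‖a‖ * Real.exp (lam * ‖a - a'‖)) := by
  obtain ⟨C, hC⟩ := hw
  refine ⟨max C 0, le_max_right _ _, fun a ha a' ha' => (hC a ha a' ha').trans ?_⟩
  gcongr
  exact le_max_left _ _

theorem CondDiagStar.exists_nonneg (hw : CondDiagStar Ω w γ lam) :
    ∃ C, 0 ≤ C ∧ ∀ a ∈ Ω, ∀ a' ∈ Ω,
      ‖w a a'‖ ≤ C * (‖a - a'‖ ^ γ / ‖a‖ * Real.exp (lam * ‖a - a'‖)) := by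
  obtain ⟨C, hC⟩ := hw.bound
  refine ⟨max C 0, le_max_right _ _, fun a ha a' ha' => (hC a ha a' ha').trans ?_⟩
  gcongr
  exact le_max_left _ _

/-- A power is dominated by an exponential, uniformly on the half-line. -/
theorem exists_rpow_le_mul_exp (hγ : 0 ≤ γ) :
    ∃ K, 0 ≤ K ∧ ∀ x : ℝ, 0 ≤ x → x ^ γ ≤ K * Real.exp x := by
  obtain rfl | hγ := hγ.eq_or_lt
  · exact ⟨1, zero_le_one, fun x hx => by simpa using hx⟩
  refine ⟨γ ^ γ, by positivity, fun x hx => ?_⟩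
  -- Raising this to the power `γ` turns the right side into `exp x` and produces the constant `γ ^
  -- γ`.
  have h1 : x / γ ≤ Real.exp (x / γ) := by linarith [Real.add_one_le_exp (x / γ)]
  have h2 := Real.rpow_le_rpow (by positivity) h1 hγ.le
  rw [← Real.exp_mul, div_mul_cancel₀ _ hγ.ne', Real.div_rpow hx hγ.le,
    div_le_iff₀ (by positivity)] at h2
  linarith

/-- The factor `|a - a'|^γ` is absorbed by one extra unit of exponential rate, so convergence and
holomorphy need to be proved only under `CondDiag`. -/
theorem CondDiagStar.condDiag (hw : CondDiagStar Ω w γ lam) : CondDiag Ω w (lam + 1) := by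
  obtain ⟨C, hC0, hC⟩ := hw.exists_nonneg
  obtain ⟨K, hK0, hK⟩ := exists_rpow_le_mul_exp hw.pos.le
  refine ⟨C * K, fun a ha a' ha' => (hC a ha a' ha').trans ?_⟩
  have h := hK ‖a - a'‖ (norm_nonneg _)
  calc C * (‖a - a'‖ ^ γ / ‖a‖ * Real.exp (lam * ‖a - a'‖))
      ≤ C * (K * Real.exp ‖a - a'‖ / ‖a‖ * Real.exp (lam * ‖a - a'‖)) := by gcongr
    _ = C * K * (1 / ‖a‖ * Real.exp ((lam + 1) * ‖a - a'‖)) := by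
        rw [add_mul, one_mul, Real.exp_add]; ring

/-! ### Convergence and holomorphy of the Volterra integral -/

theorem isHolomorphicKernel_sepKernel (hp : DifferentiableOn ℂ p Ω) (hq : DifferentiableOn ℂ q Ω)
    (hp0 : ∀ a ∈ Ω, p a ≠ 0) : IsHolomorphicKernel Ω (sepKernel p q) := by
  unfold IsHolomorphicKernel sepKernel
  have h1 : MapsTo (Prod.fst : ℂ × ℂ → ℂ) (Ω ×ˢ Ω) Ω := fun x hx => hx.1
  have h2 : MapsTo (Prod.snd : ℂ × ℂ → ℂ) (Ω ×ˢ Ω) Ω := fun x hx => hx.2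
  have h3 : DifferentiableOn ℂ (fun x : ℂ × ℂ => p x.1) (Ω ×ˢ Ω) :=
    hp.comp (𝕜 := ℂ) differentiable_fst.differentiableOn h1
  have h4 : DifferentiableOn ℂ (fun x : ℂ × ℂ => q x.2) (Ω ×ˢ Ω) :=
    hq.comp (𝕜 := ℂ) differentiable_snd.differentiableOn h2
  simp only [div_eq_mul_inv]
  exact (h4.fun_mul (h3.fun_inv fun x hx => hp0 _ (h1 hx))).fun_neg

/-- The Volterra integrand at `t` is holomorphic in the end point. -/
theorem IsHolomorphicKernel.differentiableOn_integrand (hΩ : IsDomain Ω)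
    (hw : IsHolomorphicKernel Ω w) (hf : DifferentiableOn ℂ f Ω) (ht : t ∈ Ioc (0 : ℝ) 1) :
    DifferentiableOn ℂ (fun a => volterraIntegrand w f a t) Ω := by
  have h1 : DifferentiableOn ℂ (fun a : ℂ => (t : ℂ) * a) Ω :=
    (differentiable_id.const_mul (t : ℂ)).differentiableOn
  have hm : MapsTo (fun a : ℂ => (t : ℂ) * a) Ω Ω := fun a ha => hΩ.star a ha t ht
  have h2 : DifferentiableOn ℂ (fun a : ℂ => w a ((t : ℂ) * a)) Ω :=
    DifferentiableOn.comp (g := fun x : ℂ × ℂ => w x.1 x.2) (f := fun a : ℂ => (a, (t : ℂ) * a)) hw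
      (differentiableOn_id.prodMk h1) fun a ha => ⟨ha, hm ha⟩
  exact (h2.mul (hf.comp h1 hm)).mul differentiableOn_id

theorem IsHolomorphicKernel.continuousOn_integrand (hΩ : IsDomain Ω)
    (hw : IsHolomorphicKernel Ω w) (hf : DifferentiableOn ℂ f Ω) (ha : a ∈ Ω) :
    ContinuousOn (volterraIntegrand w f a) (Ioc (0 : ℝ) 1) := by
  have h1 : ContinuousOn (fun t : ℝ => (t : ℂ) * a) (Ioc (0 : ℝ) 1) :=
    (Complex.continuous_ofReal.mul continuous_const).continuousOn
  have hm : MapsTo (fun t : ℝ => (t : ℂ) * a) (Ioc (0 : ℝ) 1) Ω := fun t ht => hΩ.star a ha t ht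
  have h2 : ContinuousOn (fun t : ℝ => w a ((t : ℂ) * a)) (Ioc (0 : ℝ) 1) :=
    ContinuousOn.comp (g := fun x : ℂ × ℂ => w x.1 x.2) (f := fun t : ℝ => (a, (t : ℂ) * a))
      hw.continuousOn (continuousOn_const.prodMk h1) fun t ht => ⟨ha, hm ht⟩
  exact (h2.mul (hf.continuousOn.comp h1 hm)).mul continuousOn_const

theorem IsHolomorphicKernel.aestronglyMeasurable_integrand (hΩ : IsDomain Ω)
    (hw : IsHolomorphicKernel Ω w) (hf : DifferentiableOn ℂ f Ω) (ha : a ∈ Ω) :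
    AEStronglyMeasurable (volterraIntegrand w f a) (volume.restrict (uIoc (0 : ℝ) 1)) := by
  rw [uIoc_of_le zero_le_one]
  exact (hw.continuousOn_integrand hΩ hf ha).aestronglyMeasurable measurableSet_Ioc

/-- A crude bound for the Volterra integrand, with a constant continuous in the end point. -/
theorem CondDiag.exists_norm_integrand_le (hΩ : IsDomain Ω) (hw : CondDiag Ω w lam)
    (hf : f ∈ SingExpUnion Ω σ) :
    ∃ C Λ' : ℝ, 0 ≤ C ∧ ∀ a ∈ Ω, ∀ t ∈ Ioc (0 : ℝ) 1,
      ‖volterraIntegrand w f a t‖ ≤ t ^ σ * (C * (‖a‖ ^ σ * Real.exp (Λ' * ‖a‖))) := by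
  obtain ⟨C, hC0, hC⟩ := hw.exists_nonneg
  obtain ⟨Λ, -, M, hM⟩ := mem_iUnion.1 hf
  -- The rates may be negative; their absolute values make the exponentials monotone in `t‖a‖` and
  -- `(1 - t)‖a‖`, both at most `‖a‖`.
  refine ⟨C * |M|, |lam| + |Λ|, by positivity, fun a ha t ht => ?_⟩
  have hta := hΩ.star a ha t ht
  have hpos := hΩ.norm_pos ha
  have h1 := hC a ha _ hta
  have h2 := (hM _ hta).trans (mul_le_mul_of_nonneg_right (le_abs_self M) (by positivity))
  rw [norm_sub_ofReal_mul ht.2] at h1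
  rw [norm_ofReal_mul ht.1.le, Real.mul_rpow ht.1.le (norm_nonneg _)] at h2
  have e1 : lam * ((1 - t) * ‖a‖) ≤ |lam| * ‖a‖ := by
    have : (1 - t) * ‖a‖ ≤ ‖a‖ := by nlinarith [ht.1]
    have h0 : 0 ≤ (1 - t) * ‖a‖ := mul_nonneg (by linarith [ht.2]) hpos.le
    calc _ ≤ |lam| * ((1 - t) * ‖a‖) := by gcongr; exact le_abs_self _
      _ ≤ _ := by gcongr
  have e2 : Λ * (t * ‖a‖) ≤ |Λ| * ‖a‖ := by
    have : t * ‖a‖ ≤ ‖a‖ := by nlinarith [ht.2]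
    have h0 : 0 ≤ t * ‖a‖ := mul_nonneg ht.1.le hpos.le
    calc _ ≤ |Λ| * (t * ‖a‖) := by gcongr; exact le_abs_self _
      _ ≤ _ := by gcongr
  unfold volterraIntegrand
  rw [norm_mul, norm_mul]
  have htσ : 0 ≤ t ^ σ := Real.rpow_nonneg ht.1.le _
  calc ‖w a (t * a)‖ * ‖f (t * a)‖ * ‖a‖
      ≤ (C * (1 / ‖a‖ * Real.exp (lam * ((1 - t) * ‖a‖)))) *
          (|M| * (t ^ σ * ‖a‖ ^ σ * Real.exp (Λ * (t * ‖a‖)))) * ‖a‖ := by gcongr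
    _ ≤ (C * (1 / ‖a‖ * Real.exp (|lam| * ‖a‖))) *
          (|M| * (t ^ σ * ‖a‖ ^ σ * Real.exp (|Λ| * ‖a‖))) * ‖a‖ := by gcongr
    _ = _ := by
      rw [add_mul, Real.exp_add]; field_simp

theorem CondDiag.volterraConverges (hΩ : IsDomain Ω) (hw : CondDiag Ω w lam)
    (hw' : IsHolomorphicKernel Ω w) (hσ : -1 < σ) (hf : f ∈ SingExpUnion Ω σ) (ha : a ∈ Ω) :
    VolterraConverges w f a := by
  obtain ⟨C, Λ', -, h⟩ := hw.exists_norm_integrand_le hΩ hf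
  obtain ⟨Λ, hf', -⟩ := mem_iUnion.1 hf
  refine (intervalIntegrable_rpow_zero_one hσ (C * (‖a‖ ^ σ * Real.exp (Λ' * ‖a‖)))).mono_fun'
    (hw'.aestronglyMeasurable_integrand hΩ hf' ha)
    ((ae_restrict_iff' measurableSet_uIoc).2 (Eventually.of_forall fun t ht => ?_))
  rw [uIoc_of_le zero_le_one] at ht
  exact h a ha t ht

theorem CondDiag.norm_volterra_le (hΩ : IsDomain Ω) (hw : CondDiag Ω w lam) (hσ : -1 < σ)
    (hf : f ∈ SingExpUnion Ω σ) :
    ∃ C Λ' : ℝ, 0 ≤ C ∧ ∀ a ∈ Ω, ‖volterra w f a‖ ≤ C * (‖a‖ ^ σ * Real.exp (Λ' * ‖a‖)) := by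
  obtain ⟨C, Λ', hC, h⟩ := hw.exists_norm_integrand_le hΩ hf
  refine ⟨C / (σ + 1), Λ', div_nonneg hC (by linarith), fun a ha => ?_⟩
  have := intervalIntegral.norm_integral_le_of_norm_le zero_le_one
    (Eventually.of_forall fun t ht => h a ha t ht) (intervalIntegrable_rpow_zero_one hσ _)
  rw [integral_rpow_zero_one hσ] at this
  refine this.trans (le_of_eq ?_)
  ring

/-- The Volterra integral is a holomorphic function of the end point. -/
theorem CondDiag.differentiableOn_volterra (hΩ : IsDomain Ω) (hw : CondDiag Ω w lam)
    (hw' : IsHolomorphicKernel Ω w) (hσ : -1 < σ) (hf : f ∈ SingExpUnion Ω σ) :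
    DifferentiableOn ℂ (volterra w f) Ω := by
  intro a ha
  obtain ⟨C, Λ', hC, h⟩ := hw.exists_norm_integrand_le hΩ hf
  obtain ⟨Λ, hf', -⟩ := mem_iUnion.1 hf
  obtain ⟨r, hr, hrΩ⟩ := Metric.nhds_basis_closedBall.mem_iff.1 (hΩ.isOpen.mem_nhds ha)
  have hcont : ContinuousOn (fun z : ℂ => C * (‖z‖ ^ σ * Real.exp (Λ' * ‖z‖)))
      (Metric.closedBall a r) := by
    refine continuousOn_const.mul (ContinuousOn.mul ?_ (by fun_prop))
    exact continuous_norm.continuousOn.rpow_const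
      fun z hz => Or.inl (hΩ.norm_pos (hrΩ hz)).ne'
  obtain ⟨G, hG⟩ := (isCompact_closedBall a r).bddAbove_image hcont
  have hG' : ∀ z ∈ Metric.closedBall a r, ∀ t ∈ Ioc (0 : ℝ) 1,
      ‖volterraIntegrand w f z t‖ ≤ t ^ σ * G := fun z hz t ht =>
    (h z (hrΩ hz) t ht).trans
      (mul_le_mul_of_nonneg_left (hG (mem_image_of_mem _ hz)) (Real.rpow_nonneg ht.1.le _))
  have hd : ∀ t ∈ Ioc (0 : ℝ) 1, ∀ z ∈ Metric.ball a (r / 2),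
      HasDerivAt (fun z => volterraIntegrand w f z t)
        (deriv (fun z => volterraIntegrand w f z t) z) z := fun t ht z hz =>
    ((hw'.differentiableOn_integrand hΩ hf' ht).differentiableAt (hΩ.isOpen.mem_nhds
      (hrΩ (Metric.ball_subset_closedBall
        (Metric.ball_subset_ball (by linarith) hz))))).hasDerivAt
  have hae : ∀ {P : ℝ → Prop}, (∀ t ∈ Ioc (0 : ℝ) 1, P t) →
      ∀ᵐ t ∂volume, t ∈ uIoc (0 : ℝ) 1 → P t := fun hP =>
    Eventually.of_forall fun t ht => hP t (by rwa [uIoc_of_le zero_le_one] at ht)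
  have hconst : ∀ n : ℕ, a + ((r / (n + 1 : ℝ) : ℝ) : ℂ) ∈ Metric.closedBall a r := by
    intro n
    rw [Metric.mem_closedBall, dist_self_add_left, Complex.norm_real,
      Real.norm_of_nonneg (by positivity)]
    exact div_le_self hr.le (by linarith [n.cast_nonneg (α := ℝ)])
  -- Around each point of the half-radius ball a closed disc of radius `r / 2` still lies in the
  -- closed ball, so Cauchy's estimate bounds the derivative by `t ^ σ * (G / (r / 2))`.
  refine (intervalIntegral.hasDerivAt_integral_of_dominated_loc_of_deriv_le
    (F := fun z t => volterraIntegrand w f z t)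
    (F' := fun z t => deriv (fun z => volterraIntegrand w f z t) z)
    (bound := fun t => t ^ σ * (G / (r / 2))) (Metric.ball_mem_nhds a (half_pos hr))
    ?_ (hw.volterraConverges hΩ hw' hσ hf ha) ?_ ?_ (intervalIntegrable_rpow_zero_one hσ _)
    (hae hd)).2.differentiableAt.differentiableWithinAt
  · filter_upwards [hΩ.isOpen.mem_nhds ha] with z hz
    exact hw'.aestronglyMeasurable_integrand hΩ hf' hz
  -- The derivative is measurable in `t` as a pointwise limit of difference quotients with steps `r
  -- / (n + 1)`.
  · have hmeas : ∀ n : ℕ, AEStronglyMeasurable (fun t => (((r / (n + 1 : ℝ) : ℝ) : ℂ))⁻¹ *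
        (volterraIntegrand w f (a + ((r / (n + 1 : ℝ) : ℝ) : ℂ)) t - volterraIntegrand w f a t))
        (volume.restrict (uIoc (0 : ℝ) 1)) := fun n =>
      ((hw'.aestronglyMeasurable_integrand hΩ hf' (hrΩ (hconst n))).sub
        (hw'.aestronglyMeasurable_integrand hΩ hf' ha)).const_mul _
    refine aestronglyMeasurable_of_tendsto_ae atTop hmeas
      ((ae_restrict_iff' measurableSet_uIoc).2 (hae fun t ht => ?_))
    have hslope := hasDerivAt_iff_tendsto_slope_zero.1
      (hd t ht a (Metric.mem_ball_self (half_pos hr)))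
    have hlim : Tendsto (fun n : ℕ => ((r / (n + 1 : ℝ) : ℝ) : ℂ)) atTop (𝓝[≠] 0) := by
      refine tendsto_nhdsWithin_iff.2 ⟨?_, Eventually.of_forall fun n => ?_⟩
      · have := (tendsto_one_div_add_atTop_nhds_zero_nat (𝕜 := ℝ)).const_mul r
        rw [mul_zero] at this
        rw [← Complex.ofReal_zero]
        refine (Complex.continuous_ofReal.tendsto 0).comp (this.congr fun n => ?_)
        ring
      · have : r / (n + 1 : ℝ) ≠ 0 := by positivity
        exact Complex.ofReal_ne_zero.2 this
    simpa only [smul_eq_mul, Function.comp_def] using hslope.comp hlim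
  · refine hae fun t ht z hz => ?_
    have hsub : Metric.closedBall z (r / 2) ⊆ Metric.closedBall a r :=
      Metric.closedBall_subset_closedBall' (by linarith [Metric.mem_ball.1 hz])
    have := Complex.norm_deriv_le_of_forall_mem_sphere_norm_le (half_pos hr)
      (((hw'.differentiableOn_integrand hΩ hf' ht).mono
        (hsub.trans hrΩ)).diffContOnCl_ball Subset.rfl)
      fun y hy => hG' y (hsub (Metric.sphere_subset_closedBall hy)) t ht
    rwa [mul_div_assoc] at this

/-! ### Operator norms for large exponential weight -/

/-- A pointwise bound for the Volterra integrand in terms of bounds for its two factors. -/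
theorem norm_integrand_le (ha : 0 < ‖a‖) (ht : 0 ≤ t) (hκ : 0 ≤ κ)
    (hw : ‖w a ((t : ℂ) * a)‖ ≤ κ / ‖a‖)
    (hf : ‖f ((t : ℂ) * a)‖ ≤
      M * (‖(t : ℂ) * a‖ ^ σ * Real.exp (Λ * ‖(t : ℂ) * a‖))) :
    ‖volterraIntegrand w f a t‖ ≤ t ^ σ * (κ * M * (‖a‖ ^ σ * Real.exp (Λ * (t * ‖a‖)))) := by
  rw [norm_ofReal_mul ht, Real.mul_rpow ht ha.le] at hf
  unfold volterraIntegrand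
  rw [norm_mul, norm_mul]
  calc ‖w a (t * a)‖ * ‖f (t * a)‖ * ‖a‖
      ≤ (κ / ‖a‖) * (M * (t ^ σ * ‖a‖ ^ σ * Real.exp (Λ * (t * ‖a‖)))) * ‖a‖ := by gcongr
    _ = _ := by field_simp

theorem norm_volterra_le_of_norm_integrand_le (hσ : -1 < σ) {c : ℝ}
    (h : ∀ t ∈ Ioc (0 : ℝ) 1, ‖volterraIntegrand w f a t‖ ≤ t ^ σ * c) :
    ‖volterra w f a‖ ≤ c / (σ + 1) := by
  have := intervalIntegral.norm_integral_le_of_norm_le zero_le_one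
    (Eventually.of_forall h) (intervalIntegrable_rpow_zero_one hσ _)
  rwa [integral_rpow_zero_one hσ] at this

theorem tendsto_integral_rpow_mul_exp_neg (hσ : -1 < σ) :
    Tendsto (fun μ : ℝ => ∫ t in (0 : ℝ)..1, t ^ σ * Real.exp (-(μ * (1 - t)))) atTop (𝓝 0) := by
  suffices h : Tendsto (fun μ : ℝ => ∫ t in (0 : ℝ)..1, t ^ σ * Real.exp (-(μ * (1 - t)))) atTop
      (𝓝 (∫ t in (0 : ℝ)..1, (0 : ℝ))) by
    rwa [intervalIntegral.integral_zero] at h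
  refine intervalIntegral.tendsto_integral_filter_of_dominated_convergence
    (fun t : ℝ => t ^ σ * 1) (Eventually.of_forall fun μ => ?_) ?_
    (intervalIntegrable_rpow_zero_one hσ 1) ?_
  · exact Measurable.aestronglyMeasurable (by fun_prop)
  · filter_upwards [eventually_ge_atTop 0] with μ hμ
    refine Eventually.of_forall fun t ht => ?_
    rw [uIoc_of_le zero_le_one] at ht
    have h1 : 0 ≤ t ^ σ := Real.rpow_nonneg ht.1.le _
    rw [norm_mul, Real.norm_of_nonneg h1, Real.norm_of_nonneg (Real.exp_pos _).le]
    gcongr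
    exact Real.exp_le_one_iff.2 (by nlinarith [ht.2])
  -- At `t = 1` the exponential is constantly `1`, so pointwise decay holds only off this null set.
  · have : ∀ᵐ t : ℝ, t ≠ 1 := by simp [ae_iff, measure_singleton]
    filter_upwards [this] with t ht1 ht
    rw [uIoc_of_le zero_le_one] at ht
    have h1 : 0 < 1 - t := sub_pos.2 (lt_of_le_of_ne ht.2 ht1)
    rw [← mul_zero (t ^ σ)]
    refine Tendsto.const_mul _ ?_
    exact Real.tendsto_exp_neg_atTop_nhds_zero.comp (tendsto_id.atTop_mul_const h1)

/-- A kernel with a regular singularity acts on `SingExp Ω (ρ - 1) Λ` with norm at most about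
`σ / ρ` once `Λ` is large. -/
theorem CondDiag.eventually_norm_volterra_le (hΩ : IsDomain Ω) (hw : CondDiag Ω w lam)
    (hσ : 0 < σ) (hρ : 0 < ρ)
    (hnear : ∀ᶠ x in 𝓝[Ω ×ˢ Ω] ((0 : ℂ), (0 : ℂ)), ‖w x.1 x.2‖ < σ / ‖x.1‖)
    (hθ : σ / ρ ≤ θ) :
    ∀ᶠ Λ in atTop, ∀ (f : ℂ → ℂ) (M : ℝ), 0 ≤ M →
      (∀ z ∈ Ω, ‖f z‖ ≤ M * (‖z‖ ^ (ρ - 1) * Real.exp (Λ * ‖z‖))) →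
      ∀ a ∈ Ω, ‖volterra w f a‖ ≤ θ * M * (‖a‖ ^ (ρ - 1) * Real.exp (Λ * ‖a‖)) := by
  obtain ⟨C, hC0, hC⟩ := hw.exists_nonneg
  have hρ' : -1 < ρ - 1 := by linarith
  have hθ0 : 0 < θ := (div_pos hσ hρ).trans_le hθ
  obtain ⟨δ, hδ, hδΩ⟩ := Metric.mem_nhdsWithin_iff.1 hnear
  -- The integral is the gain available for `‖a‖ ≥ δ`; it tends to `0` and so eventually beats the
  -- constant `C`, over which there is no control.
  have hJ : ∀ᶠ Λ : ℝ in atTop,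
      (∫ t in (0 : ℝ)..1, t ^ (ρ - 1) * Real.exp (-((Λ - lam) * δ * (1 - t)))) * C < θ := by
    have h1 : Tendsto (fun Λ : ℝ => (Λ - lam) * δ) atTop atTop :=
      (tendsto_atTop_add_const_right _ (-lam) tendsto_id).atTop_mul_const hδ
    have h2 := ((tendsto_integral_rpow_mul_exp_neg hρ').comp h1).mul_const C
    rw [zero_mul] at h2
    exact h2.eventually_lt_const hθ0
  filter_upwards [hJ, eventually_ge_atTop 0, eventually_ge_atTop lam] with Λ hJΛ hΛ hΛlam f M hM hf
    a ha
  have hpos := hΩ.norm_pos ha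
  obtain hlt | hge := lt_or_ge ‖a‖ δ
  -- Close to `0` the exponential gives no gain: it is bounded by its value at the end point, and
  -- the factor `σ / ρ` comes from `∫₀¹ t^(ρ-1) dt` alone.
  · have key : ∀ t ∈ Ioc (0 : ℝ) 1, ‖volterraIntegrand w f a t‖ ≤
        t ^ (ρ - 1) * (σ * M * (‖a‖ ^ (ρ - 1) * Real.exp (Λ * ‖a‖))) := by
      intro t ht
      have hta := hΩ.star a ha t ht
      have hta' : ‖(t : ℂ) * a‖ ≤ ‖a‖ := by
        rw [norm_ofReal_mul ht.1.le]; nlinarith [ht.2]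
      have hmem : ((a, (t : ℂ) * a) : ℂ × ℂ) ∈ Metric.ball ((0 : ℂ), (0 : ℂ)) δ ∩ Ω ×ˢ Ω := by
        refine ⟨?_, ha, hta⟩
        rw [Metric.mem_ball, Prod.dist_eq, max_lt_iff, dist_zero_right, dist_zero_right]
        exact ⟨hlt, hta'.trans_lt hlt⟩
      have h1 : ‖w a ((t : ℂ) * a)‖ < σ / ‖a‖ := hδΩ hmem
      refine (norm_integrand_le hpos ht.1.le hσ.le h1.le (hf _ hta)).trans ?_
      have h2 : t * ‖a‖ ≤ ‖a‖ := by nlinarith [ht.2]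
      have h3 : 0 ≤ t ^ (ρ - 1) := Real.rpow_nonneg ht.1.le _
      gcongr
    refine (norm_volterra_le_of_norm_integrand_le hρ' key).trans ?_
    calc _ = σ / ρ * M * (‖a‖ ^ (ρ - 1) * Real.exp (Λ * ‖a‖)) := by
          rw [sub_add_cancel]; ring
      _ ≤ _ := by gcongr
  · have key : ∀ t ∈ Ioc (0 : ℝ) 1, ‖volterraIntegrand w f a t‖ ≤
        t ^ (ρ - 1) * Real.exp (-((Λ - lam) * δ * (1 - t))) *
          (C * M * (‖a‖ ^ (ρ - 1) * Real.exp (Λ * ‖a‖))) := by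
      intro t ht
      have hta := hΩ.star a ha t ht
      have h1 := hC a ha _ hta
      rw [norm_sub_ofReal_mul ht.2, ← mul_assoc, mul_one_div, div_mul_eq_mul_div] at h1
      refine (norm_integrand_le hpos ht.1.le (by positivity) h1 (hf _ hta)).trans ?_
      have h3 : 0 ≤ t ^ (ρ - 1) := Real.rpow_nonneg ht.1.le _
      -- The left side equals `Λ‖a‖ - (Λ - lam)(1 - t)‖a‖`, and here `‖a‖ ≥ δ`.
      have h4 : lam * ((1 - t) * ‖a‖) + Λ * (t * ‖a‖) ≤
          -((Λ - lam) * δ * (1 - t)) + Λ * ‖a‖ := by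
        have : 0 ≤ (Λ - lam) * (1 - t) * (‖a‖ - δ) :=
          mul_nonneg (mul_nonneg (by linarith) (by linarith [ht.2])) (by linarith)
        nlinarith
      calc _ = t ^ (ρ - 1) * (C * M * (‖a‖ ^ (ρ - 1) *
            Real.exp (lam * ((1 - t) * ‖a‖) + Λ * (t * ‖a‖)))) := by rw [Real.exp_add]; ring
        _ ≤ t ^ (ρ - 1) * (C * M * (‖a‖ ^ (ρ - 1) *
            Real.exp (-((Λ - lam) * δ * (1 - t)) + Λ * ‖a‖))) := by gcongr
        _ = _ := by rw [Real.exp_add]; ring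
    have hint : IntervalIntegrable (fun t : ℝ =>
        t ^ (ρ - 1) * Real.exp (-((Λ - lam) * δ * (1 - t)))) volume 0 1 :=
      (intervalIntegral.intervalIntegrable_rpow' hρ').mul_continuousOn (by fun_prop)
    have := intervalIntegral.norm_integral_le_of_norm_le zero_le_one
      (Eventually.of_forall key) (hint.mul_const _)
    rw [intervalIntegral.integral_mul_const, mul_assoc C, ← mul_assoc _ C] at this
    refine this.trans ?_
    rw [mul_assoc θ]
    gcongr

/-- A kernel vanishing to order `γ` on the diagonal acts on `SingExp Ω (ρ - 1) Λ` with
arbitrarily small norm once `Λ` is large. -/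
theorem CondDiagStar.eventually_norm_volterra_le (hΩ : IsDomain Ω) (hw : CondDiagStar Ω w γ lam)
    (hρ : 0 < ρ) (hθ : 0 < θ) :
    ∀ᶠ Λ in atTop, ∀ (f : ℂ → ℂ) (M : ℝ), 0 ≤ M →
      (∀ z ∈ Ω, ‖f z‖ ≤ M * (‖z‖ ^ (ρ - 1) * Real.exp (Λ * ‖z‖))) →
      ∀ a ∈ Ω, ‖volterra w f a‖ ≤ θ * M * (‖a‖ ^ (ρ - 1) * Real.exp (Λ * ‖a‖)) := by
  obtain ⟨C, hC0, hC⟩ := hw.exists_nonneg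
  obtain ⟨K, hK0, hK⟩ := exists_rpow_le_mul_exp hw.pos.le
  have hρ' : -1 < ρ - 1 := by linarith
  have hlim : ∀ᶠ Λ : ℝ in atTop, C * (K * (Λ - lam) ^ (-γ)) / ρ < θ := by
    have h1 := (tendsto_rpow_neg_atTop hw.pos).comp
      (tendsto_atTop_add_const_right atTop (-lam) tendsto_id)
    have h2 := ((h1.const_mul K).const_mul C).div_const ρ
    rw [mul_zero, mul_zero, zero_div] at h2
    exact h2.eventually_lt_const hθ
  filter_upwards [hlim, eventually_gt_atTop lam] with Λ hΛ hΛlam f M hM hf a ha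
  have hpos := hΩ.norm_pos ha
  have hμ : 0 < Λ - lam := sub_pos.2 hΛlam
  have key : ∀ t ∈ Ioc (0 : ℝ) 1, ‖volterraIntegrand w f a t‖ ≤
      t ^ (ρ - 1) * (C * (K * (Λ - lam) ^ (-γ)) * M *
        (‖a‖ ^ (ρ - 1) * Real.exp (Λ * ‖a‖))) := by
    intro t ht
    have hta := hΩ.star a ha t ht
    have h1 := hC a ha _ hta
    have hx : 0 ≤ (1 - t) * ‖a‖ := mul_nonneg (by linarith [ht.2]) hpos.le
    rw [norm_sub_ofReal_mul ht.2, div_mul_eq_mul_div, ← mul_div_assoc] at h1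
    refine (norm_integrand_le hpos ht.1.le (by positivity) h1 (hf _ hta)).trans ?_
    have h3 : 0 ≤ t ^ (ρ - 1) := Real.rpow_nonneg ht.1.le _
    -- At this argument the bound trades the factor `((1 - t)‖a‖)^γ` for `(Λ - lam)^(-γ)`, and the
    -- three exponentials then multiply to exactly `exp (Λ‖a‖)`.
    have h4 := hK ((Λ - lam) * ((1 - t) * ‖a‖)) (by positivity)
    have h5 : ((1 - t) * ‖a‖) ^ γ ≤
        K * (Λ - lam) ^ (-γ) * Real.exp ((Λ - lam) * ((1 - t) * ‖a‖)) := by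
      rw [Real.mul_rpow hμ.le hx] at h4
      rw [Real.rpow_neg hμ.le, mul_right_comm, ← div_eq_mul_inv,
        le_div_iff₀ (Real.rpow_pos_of_pos hμ γ), mul_comm]
      exact h4
    calc _ ≤ t ^ (ρ - 1) * (C * (K * (Λ - lam) ^ (-γ) *
          Real.exp ((Λ - lam) * ((1 - t) * ‖a‖)) * Real.exp (lam * ((1 - t) * ‖a‖))) * M *
            (‖a‖ ^ (ρ - 1) * Real.exp (Λ * (t * ‖a‖)))) := by gcongr
      _ = t ^ (ρ - 1) * (C * (K * (Λ - lam) ^ (-γ)) * M * (‖a‖ ^ (ρ - 1) *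
          (Real.exp ((Λ - lam) * ((1 - t) * ‖a‖)) * Real.exp (lam * ((1 - t) * ‖a‖)) *
            Real.exp (Λ * (t * ‖a‖))))) := by ring
      _ = _ := by rw [← Real.exp_add, ← Real.exp_add]; ring_nf
  refine (norm_volterra_le_of_norm_integrand_le hρ' key).trans ?_
  calc _ = C * (K * (Λ - lam) ^ (-γ)) / ρ * M * (‖a‖ ^ (ρ - 1) * Real.exp (Λ * ‖a‖)) := by
        rw [sub_add_cancel]; ring
    _ ≤ _ := by gcongr

/-! ### Powers defined by a branch of the logarithm -/

theorem IsLogBranch.norm_branchPow (hL : IsLogBranch Ω L) (hz : z ∈ Ω) :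
    ‖branchPow L s z‖ = ‖z‖ ^ s := by
  conv_rhs => rw [← hL.2 z hz]
  rw [branchPow, Complex.norm_exp, Complex.norm_exp, Complex.re_ofReal_mul, mul_comm, Real.exp_mul]

theorem IsLogBranch.differentiableOn_branchPow (hL : IsLogBranch Ω L) :
    DifferentiableOn ℂ (branchPow L s) Ω :=
  (hL.1.const_mul (s : ℂ)).cexp

theorem IsLogBranch.branchPow_mem (hL : IsLogBranch Ω L) :
    branchPow L s ∈ SingExpUnion Ω s :=
  mem_iUnion.2 ⟨0, hL.differentiableOn_branchPow, 1, fun z hz => by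
    simp [hL.norm_branchPow hz]⟩

theorem IsLogBranch.hasDerivAt (hΩ : IsDomain Ω) (hL : IsLogBranch Ω L) (hz : z ∈ Ω) :
    HasDerivAt L z⁻¹ z := by
  have h1 := (hL.1.differentiableAt (hΩ.isOpen.mem_nhds hz)).hasDerivAt
  have h2 : HasDerivAt (fun y => Complex.exp (L y)) 1 z :=
    (hasDerivAt_id z).congr_of_eventuallyEq
      (by filter_upwards [hΩ.isOpen.mem_nhds hz] with y hy using hL.2 y hy)
  have h3 := h1.cexp.unique h2
  rw [hL.2 z hz] at h3
  rwa [← eq_inv_of_mul_eq_one_right h3]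

/-- Along a ray, `L (u a) - log u` has zero derivative in `u`, so its values at `u = t` and `u = 1`
agree. No branch jump can occur, whichever branch `L` is. -/
theorem IsLogBranch.ofReal_mul (hΩ : IsDomain Ω) (hL : IsLogBranch Ω L) (ha : a ∈ Ω)
    (ht : t ∈ Ioc (0 : ℝ) 1) : L ((t : ℂ) * a) = L a + (Real.log t : ℂ) := by
  have hd : ∀ u ∈ Icc t 1,
      HasDerivAt (fun u : ℝ => L ((u : ℂ) * a) - (Real.log u : ℂ)) 0 u := by
    intro u hu
    have hu0 : 0 < u := ht.1.trans_le hu.1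
    have h1 : HasDerivAt (fun y : ℂ => L (y * a)) (((u : ℂ) * a)⁻¹ * (1 * a)) (u : ℂ) :=
      (hL.hasDerivAt hΩ (hΩ.star a ha u ⟨hu0, hu.2⟩)).comp (u : ℂ)
        ((hasDerivAt_id (u : ℂ)).mul_const a)
    have h2 := h1.comp_ofReal.sub (Real.hasDerivAt_log hu0.ne').ofReal_comp
    convert! h2 using 1
    have h3 := hΩ.ne_zero ha
    have h4 : (u : ℂ) ≠ 0 := Complex.ofReal_ne_zero.2 hu0.ne'
    push_cast
    field_simp
    simp
  have := constant_of_has_deriv_right_zero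
    (fun u hu => (hd u hu).continuousAt.continuousWithinAt)
    (fun u hu => (hd u ⟨hu.1, hu.2.le⟩).hasDerivWithinAt) 1 ⟨ht.2, le_rfl⟩
  simp only [Complex.ofReal_one, one_mul, Real.log_one, Complex.ofReal_zero, sub_zero] at this
  rw [this, sub_add_cancel]

theorem IsLogBranch.branchPow_ofReal_mul (hΩ : IsDomain Ω) (hL : IsLogBranch Ω L) (ha : a ∈ Ω)
    (ht : t ∈ Ioc (0 : ℝ) 1) :
    branchPow L s ((t : ℂ) * a) = ((t ^ s : ℝ) : ℂ) * branchPow L s a := by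
  unfold branchPow
  rw [hL.ofReal_mul hΩ ha ht, Real.rpow_def_of_pos ht.1, Complex.ofReal_exp, ← Complex.exp_add]
  congr 1
  push_cast
  ring

/-! ### Calculus of the spaces `SingExpUnion` and mapping properties -/

/-- Membership in the union of the spaces `SingExp Ω σ Λ`, with a bound for every large `Λ`. -/
theorem mem_singExpUnion_iff :
    f ∈ SingExpUnion Ω σ ↔ DifferentiableOn ℂ f Ω ∧ ∃ M, 0 ≤ M ∧
      ∀ᶠ Λ in atTop, ∀ z ∈ Ω, ‖f z‖ ≤ M * (‖z‖ ^ σ * Real.exp (Λ * ‖z‖)) := by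
  constructor
  · intro h
    obtain ⟨Λ₀, hf, M, hM⟩ := mem_iUnion.1 h
    refine ⟨hf, |M|, abs_nonneg _, ?_⟩
    filter_upwards [eventually_ge_atTop Λ₀] with Λ hΛ z hz
    refine (hM z hz).trans ?_
    calc M * (‖z‖ ^ σ * Real.exp (Λ₀ * ‖z‖)) ≤ |M| * (‖z‖ ^ σ * Real.exp (Λ₀ * ‖z‖)) := by
          gcongr; exact le_abs_self M
      _ ≤ _ := by gcongr
  · rintro ⟨hf, M, -, h⟩
    obtain ⟨Λ, hΛ⟩ := h.exists
    exact mem_iUnion.2 ⟨Λ, hf, M, hΛ⟩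

theorem singExpUnion_add (hf : f ∈ SingExpUnion Ω σ) (hg : g ∈ SingExpUnion Ω σ) :
    (fun z => f z + g z) ∈ SingExpUnion Ω σ := by
  obtain ⟨hf, M, hM, h1⟩ := mem_singExpUnion_iff.1 hf
  obtain ⟨hg, N, hN, h2⟩ := mem_singExpUnion_iff.1 hg
  refine mem_singExpUnion_iff.2 ⟨hf.fun_add hg, M + N, by positivity, ?_⟩
  filter_upwards [h1, h2] with Λ h1 h2 z hz
  rw [add_mul]
  exact (norm_add_le _ _).trans (add_le_add (h1 z hz) (h2 z hz))

theorem singExpUnion_sub (hf : f ∈ SingExpUnion Ω σ) (hg : g ∈ SingExpUnion Ω σ) :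
    (fun z => f z - g z) ∈ SingExpUnion Ω σ := by
  obtain ⟨hf, M, hM, h1⟩ := mem_singExpUnion_iff.1 hf
  obtain ⟨hg, N, hN, h2⟩ := mem_singExpUnion_iff.1 hg
  refine mem_singExpUnion_iff.2 ⟨hf.fun_sub hg, M + N, by positivity, ?_⟩
  filter_upwards [h1, h2] with Λ h1 h2 z hz
  rw [add_mul]
  exact (norm_sub_le _ _).trans (add_le_add (h1 z hz) (h2 z hz))

/-- Near `0` the larger power is the smaller function; far out, the surplus `|z|^(σ-σ')` is absorbed
by raising `Λ` by one. -/
theorem singExpUnion_subset (hΩ : IsDomain Ω) (h : σ' ≤ σ) :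
    SingExpUnion Ω σ ⊆ SingExpUnion Ω σ' := by
  intro f hf
  obtain ⟨Λ, hf, M, hM⟩ := mem_iUnion.1 hf
  obtain ⟨K, hK0, hK⟩ := exists_rpow_le_mul_exp (sub_nonneg.2 h)
  refine mem_iUnion.2 ⟨Λ + 1, hf, |M| * K, fun z hz => (hM z hz).trans ?_⟩
  have h1 := hK ‖z‖ (norm_nonneg z)
  have hσ : σ = σ' + (σ - σ') := by ring
  rw [hσ, Real.rpow_add (hΩ.norm_pos hz)]
  calc M * (‖z‖ ^ σ' * ‖z‖ ^ (σ - σ') * Real.exp (Λ * ‖z‖))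
      ≤ |M| * (‖z‖ ^ σ' * (K * Real.exp ‖z‖) * Real.exp (Λ * ‖z‖)) := by
        gcongr; exact le_abs_self M
    _ = _ := by rw [add_mul, one_mul, Real.exp_add]; ring

theorem CondDiag.volterra_mem (hΩ : IsDomain Ω) (hw : CondDiag Ω w lam)
    (hw' : IsHolomorphicKernel Ω w) (hσ : -1 < σ) (hf : f ∈ SingExpUnion Ω σ) :
    volterra w f ∈ SingExpUnion Ω σ := by
  obtain ⟨C, Λ, -, h⟩ := hw.norm_volterra_le hΩ hσ hf
  exact mem_iUnion.2 ⟨Λ, hw.differentiableOn_volterra hΩ hw' hσ hf, C, h⟩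

/-- A kernel vanishing to order `γ` on the diagonal improves the exponent by `γ`. -/
theorem CondDiagStar.volterra_mem (hΩ : IsDomain Ω) (hw : CondDiagStar Ω w γ lam)
    (hw' : IsHolomorphicKernel Ω w) (hσ : -1 < σ) (hf : f ∈ SingExpUnion Ω σ) :
    volterra w f ∈ SingExpUnion Ω (σ + γ) := by
  obtain ⟨C, hC0, hC⟩ := hw.exists_nonneg
  obtain ⟨-, M, hM0, hM⟩ := mem_singExpUnion_iff.1 hf
  obtain ⟨Λ, hM, hΛ⟩ := (hM.and (eventually_ge_atTop 0)).exists
  refine mem_iUnion.2 ⟨|lam| + Λ, hw.condDiag.differentiableOn_volterra hΩ hw' hσ hf,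
    C * M / (σ + 1), fun a ha => ?_⟩
  have hpos := hΩ.norm_pos ha
  refine (norm_volterra_le_of_norm_integrand_le hσ
    (c := C * M * (‖a‖ ^ (σ + γ) * Real.exp ((|lam| + Λ) * ‖a‖))) fun t ht => ?_).trans
    (le_of_eq (by ring))
  have hta := hΩ.star a ha t ht
  have h1 := hC a ha _ hta
  have hx : (1 - t) * ‖a‖ ≤ ‖a‖ := by nlinarith [ht.1]
  have hx0 : 0 ≤ (1 - t) * ‖a‖ := mul_nonneg (by linarith [ht.2]) hpos.le
  have hta' : t * ‖a‖ ≤ ‖a‖ := by nlinarith [ht.2]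
  have htσ : 0 ≤ t ^ σ := Real.rpow_nonneg ht.1.le _
  have hγ := hw.pos.le
  rw [norm_sub_ofReal_mul ht.2, div_mul_eq_mul_div, ← mul_div_assoc] at h1
  refine (norm_integrand_le hpos ht.1.le (by positivity) h1 (hM _ hta)).trans ?_
  calc t ^ σ * (C * (((1 - t) * ‖a‖) ^ γ * Real.exp (lam * ((1 - t) * ‖a‖))) * M *
        (‖a‖ ^ σ * Real.exp (Λ * (t * ‖a‖))))
      ≤ t ^ σ * (C * (((1 - t) * ‖a‖) ^ γ * Real.exp (|lam| * ((1 - t) * ‖a‖))) * M *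
        (‖a‖ ^ σ * Real.exp (Λ * (t * ‖a‖)))) := by gcongr; exact le_abs_self lam
    _ ≤ t ^ σ * (C * (‖a‖ ^ γ * Real.exp (|lam| * ‖a‖)) * M *
        (‖a‖ ^ σ * Real.exp (Λ * ‖a‖))) := by gcongr
    _ = _ := by rw [add_mul, Real.exp_add, Real.rpow_add hpos]; ring

theorem volterra_sub (hf : VolterraConverges w f a) (hg : VolterraConverges w g a) :
    volterra w (fun z => f z - g z) a = volterra w f a - volterra w g a := by
  unfold volterra
  rw [← intervalIntegral.integral_sub hf hg]
  congr 1
  ext t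
  unfold volterraIntegrand
  ring

/-! ### The source term of the reduced equation -/

/-- Near the singularity, the separable kernel is `τ / a` up to a relative error `O(|a| ^ β)`. -/
theorem exists_norm_sepKernel_mul_sub_le (hΩ : IsDomain Ω) (hp0 : ∀ a ∈ Ω, p a ≠ 0)
    (hsing : CondSing Ω (sepKernel p q) τ) (hreg : CondRegP Ω p B ε)
    (hβ : 0 < β) (hβε : β ≤ ε) (hβ1 : β ≤ 1) :
    ∃ δ > 0, ∃ C, 0 ≤ C ∧ ∀ a ∈ Ω, ‖a‖ < δ → ∀ z ∈ Ω, ‖z‖ ≤ ‖a‖ →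
      ‖sepKernel p q a z * a - τ‖ ≤ C * ‖a‖ ^ β := by
  obtain ⟨D, hD⟩ := hsing.diag
  obtain ⟨C₁, hC₁, hO⟩ := hreg.isBigO.exists_nonneg
  have hB : 0 < ‖B‖ := norm_pos_iff.2 hreg.ne_zero
  have hsmall : ∀ᶠ z in 𝓝[Ω] (0 : ℂ), C₁ * ‖z‖ ^ β < ‖B‖ / 2 := by
    have h1 : Tendsto (fun z : ℂ => C₁ * ‖z‖ ^ β) (𝓝 0) (𝓝 (C₁ * ‖(0 : ℂ)‖ ^ β)) :=
      ((continuous_norm.rpow_const fun _ => Or.inr hβ.le).const_mul C₁).tendsto 0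
    rw [norm_zero, Real.zero_rpow hβ.ne', mul_zero] at h1
    exact nhdsWithin_le_nhds (h1.eventually_lt_const (by positivity))
  have hone : ∀ᶠ z in 𝓝[Ω] (0 : ℂ), ‖z‖ < 1 :=
    nhdsWithin_le_nhds ((continuous_norm.tendsto (0 : ℂ)).eventually_lt_const (by simp))
  obtain ⟨δ, hδ, hall⟩ := Metric.mem_nhdsWithin_iff.1
    (hD.and (hO.bound.and (hsmall.and hone)))
  have hall' : ∀ z ∈ Ω, ‖z‖ < δ → ‖sepKernel p q z z - (τ : ℂ) / z‖ ≤ |D| ∧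
      ‖p z - B * z‖ ≤ C₁ * (‖z‖ * ‖z‖ ^ β) ∧ C₁ * ‖z‖ ^ β < ‖B‖ / 2 ∧ ‖z‖ ≤ ‖z‖ ^ β := by
    intro z hz hzδ
    obtain ⟨h1, h2, h3, h4⟩ := hall ⟨by simpa using hzδ, hz⟩
    have hpos := hΩ.norm_pos hz
    refine ⟨h1.trans (le_abs_self D), h2.trans ?_, h3, ?_⟩
    · rw [Real.norm_of_nonneg (by positivity), Real.rpow_add hpos, Real.rpow_one]
      gcongr C₁ * (_ * ?_)
      exact Real.rpow_le_rpow_of_exponent_ge hpos h4.le hβε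
    · simpa using Real.rpow_le_rpow_of_exponent_ge hpos h4.le hβ1
  have hτ := hsing.pos
  refine ⟨δ, hδ, ((C₁ * (τ + |D|) + ‖B‖ * |D|) + τ * C₁) / (‖B‖ / 2), by positivity, ?_⟩
  intro a ha haδ z hz hza
  obtain ⟨-, ha2, ha3, -⟩ := hall' a ha haδ
  obtain ⟨hz1, hz2, -, hz4⟩ := hall' z hz (hza.trans_lt haδ)
  have hapos := hΩ.norm_pos ha
  have hzpos := hΩ.norm_pos hz
  have hz0 := hΩ.ne_zero hz
  -- The choice of `δ` keeps the error of `p` below half of its leading term; this is the source of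
  -- the denominator `‖B‖ / 2`.
  have hpa : ‖B‖ / 2 * ‖a‖ ≤ ‖p a‖ := by
    have h1 : ‖B * a‖ ≤ ‖p a‖ + ‖p a - B * a‖ := by
      simpa using norm_sub_le (p a) (p a - B * a)
    rw [norm_mul] at h1
    nlinarith
  have hone : ‖z‖ ^ β ≤ ‖a‖ ^ β := by gcongr
  have hz1' : ‖z * sepKernel p q z z - τ‖ ≤ |D| * ‖z‖ := by
    have : z * sepKernel p q z z - τ = (sepKernel p q z z - (τ : ℂ) / z) * z := by
      field_simp
    rw [this, norm_mul]
    gcongr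
  have hzk : ‖z * sepKernel p q z z‖ ≤ τ + |D| * ‖z‖ := by
    have h1 := norm_add_le (z * sepKernel p q z z - τ) (τ : ℂ)
    rw [sub_add_cancel, Complex.norm_real, Real.norm_of_nonneg hτ.le] at h1
    linarith
  have hz3 : ‖z‖ ≤ 1 := by
    by_contra! h
    have h1 := (hall ⟨by simpa using hza.trans_lt haδ, hz⟩).2.2.2
    linarith
  have hq : ‖-q z - B * τ‖ ≤ (C₁ * (τ + |D|) + ‖B‖ * |D|) * ‖a‖ ^ β := by
    -- Since `-q z = p z * k₀(z, z)`, the diagonal condition and the expansion of `p` together give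
    -- `-q z = Bτ + O(|z|^β)`, which frees the estimate from the diagonal.
    have e : -q z - B * τ = (p z - B * z) / z * (z * sepKernel p q z z) +
        B * (z * sepKernel p q z z - τ) := by
      have := hp0 z hz
      unfold sepKernel
      field_simp
      ring
    have h1 : ‖(p z - B * z) / z‖ ≤ C₁ * ‖z‖ ^ β := by
      rw [norm_div, div_le_iff₀ hzpos]
      linarith
    rw [e]
    calc _ ≤ ‖(p z - B * z) / z‖ * ‖z * sepKernel p q z z‖ +
          ‖B‖ * ‖z * sepKernel p q z z - τ‖ := by
          refine (norm_add_le _ _).trans ?_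
          rw [norm_mul _ (z * sepKernel p q z z), norm_mul B]
      _ ≤ C₁ * ‖z‖ ^ β * (τ + |D| * ‖z‖) + ‖B‖ * (|D| * ‖z‖) := by gcongr
      _ ≤ C₁ * ‖a‖ ^ β * (τ + |D| * 1) + ‖B‖ * (|D| * ‖a‖ ^ β) := by
          gcongr
          exact hz4.trans hone
      _ = _ := by ring
  have e : sepKernel p q a z * a - τ =
      ((-q z - B * τ) * a - τ * (p a - B * a)) / p a := by
    have := hp0 a ha
    unfold sepKernel
    field_simp
    ring
  have hpa0 : 0 < ‖p a‖ := norm_pos_iff.2 (hp0 a ha)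
  rw [e, norm_div, div_le_iff₀ hpa0]
  calc _ ≤ ‖-q z - B * τ‖ * ‖a‖ + τ * ‖p a - B * a‖ := by
        refine (norm_sub_le _ _).trans ?_
        rw [norm_mul, norm_mul, Complex.norm_real, Real.norm_of_nonneg hτ.le]
    _ ≤ (C₁ * (τ + |D|) + ‖B‖ * |D|) * ‖a‖ ^ β * ‖a‖ + τ * (C₁ * (‖a‖ * ‖a‖ ^ β)) := by gcongr
    _ = ((C₁ * (τ + |D|) + ‖B‖ * |D|) + τ * C₁) / (‖B‖ / 2) * ‖a‖ ^ β * (‖B‖ / 2 * ‖a‖) := by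
        field_simp
    _ ≤ _ := by gcongr

/-- The leading power function is an approximate fixed point of the separable Volterra
operator. -/
theorem volterra_sepKernel_branchPow_sub_mem (hΩ : IsDomain Ω) (hp : DifferentiableOn ℂ p Ω)
    (hq : DifferentiableOn ℂ q Ω) (hp0 : ∀ a ∈ Ω, p a ≠ 0)
    (hsing : CondSing Ω (sepKernel p q) τ) (hdiag : CondDiag Ω (sepKernel p q) lam)
    (hreg : CondRegP Ω p B ε) (hL : IsLogBranch Ω L)
    (hβ : 0 < β) (hβε : β ≤ ε) (hβ1 : β ≤ 1) :
    (fun a => volterra (sepKernel p q) (branchPow L (τ - 1)) a - branchPow L (τ - 1) a) ∈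
      SingExpUnion Ω (τ - 1 + β) := by
  obtain ⟨δ, hδ, C, hC0, hC⟩ := exists_norm_sepKernel_mul_sub_le hΩ hp0 hsing hreg hβ hβε hβ1
  have hτ := hsing.pos
  have hτ' : -1 < τ - 1 := by linarith
  have hker := isHolomorphicKernel_sepKernel hp hq hp0
  have hφ : branchPow L (τ - 1) ∈ SingExpUnion Ω (τ - 1) := hL.branchPow_mem
  obtain ⟨hh, M, hM0, hM⟩ := mem_singExpUnion_iff.1
    (singExpUnion_sub (hdiag.volterra_mem hΩ hker hτ' hφ) hφ)
  obtain ⟨Λ, hM, hΛ⟩ := (hM.and (eventually_ge_atTop 0)).exists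
  -- The first summand of the constant serves `‖a‖ < δ`, the second `‖a‖ ≥ δ`.
  refine mem_iUnion.2 ⟨Λ, hh, C / τ + M * (δ ^ β)⁻¹, fun a ha => ?_⟩
  have hpos := hΩ.norm_pos ha
  have hw0 : 0 ≤ ‖a‖ ^ (τ - 1 + β) := by positivity
  obtain hlt | hge := lt_or_ge ‖a‖ δ
  · have hint : IntervalIntegrable
        (fun t : ℝ => ((t ^ (τ - 1) * τ : ℝ) : ℂ) * branchPow L (τ - 1) a) volume 0 1 :=
      IntervalIntegrable.mul_const ⟨(intervalIntegrable_rpow_zero_one hτ' τ).1.ofReal,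
        (intervalIntegrable_rpow_zero_one hτ' τ).2.ofReal⟩ _
    have hval : ∫ t in (0 : ℝ)..1, ((t ^ (τ - 1) * τ : ℝ) : ℂ) * branchPow L (τ - 1) a =
        branchPow L (τ - 1) a := by
      rw [intervalIntegral.integral_mul_const, intervalIntegral.integral_ofReal,
        integral_rpow_zero_one hτ', sub_add_cancel, div_self hτ.ne', Complex.ofReal_one, one_mul]
    have hsub : volterra (sepKernel p q) (branchPow L (τ - 1)) a - branchPow L (τ - 1) a =
        ∫ t in (0 : ℝ)..1, (volterraIntegrand (sepKernel p q) (branchPow L (τ - 1)) a t -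
          ((t ^ (τ - 1) * τ : ℝ) : ℂ) * branchPow L (τ - 1) a) := by
      rw [intervalIntegral.integral_sub (hdiag.volterraConverges hΩ hker hτ' hφ ha) hint, hval]
      rfl
    have key : ∀ t ∈ Ioc (0 : ℝ) 1,
        ‖volterraIntegrand (sepKernel p q) (branchPow L (τ - 1)) a t -
          ((t ^ (τ - 1) * τ : ℝ) : ℂ) * branchPow L (τ - 1) a‖ ≤
        t ^ (τ - 1) * (C * ‖a‖ ^ (τ - 1 + β)) := by
      intro t ht
      have hta := hΩ.star a ha t ht
      have h1 := hC a ha hlt _ hta (by rw [norm_ofReal_mul ht.1.le]; nlinarith [ht.2])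
      have htσ : 0 ≤ t ^ (τ - 1) := Real.rpow_nonneg ht.1.le _
      have e : volterraIntegrand (sepKernel p q) (branchPow L (τ - 1)) a t -
          ((t ^ (τ - 1) * τ : ℝ) : ℂ) * branchPow L (τ - 1) a =
          (sepKernel p q a ((t : ℂ) * a) * a - τ) *
            (((t ^ (τ - 1) : ℝ) : ℂ) * branchPow L (τ - 1) a) := by
        unfold volterraIntegrand
        rw [hL.branchPow_ofReal_mul hΩ ha ht]
        push_cast
        ring
      rw [e, norm_mul, norm_mul, Complex.norm_real, Real.norm_of_nonneg htσ,
        hL.norm_branchPow ha]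
      calc _ ≤ C * ‖a‖ ^ β * (t ^ (τ - 1) * ‖a‖ ^ (τ - 1)) := by gcongr
        _ = _ := by rw [Real.rpow_add hpos]; ring
    have h2 := intervalIntegral.norm_integral_le_of_norm_le zero_le_one
      (Eventually.of_forall key) (intervalIntegrable_rpow_zero_one hτ' _)
    rw [← hsub, integral_rpow_zero_one hτ', sub_add_cancel] at h2
    refine h2.trans ?_
    calc C * ‖a‖ ^ (τ - 1 + β) / τ = (C / τ + 0) * (‖a‖ ^ (τ - 1 + β) * 1) := by ring
      _ ≤ _ := by
        gcongr
        · positivity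
        · exact Real.one_le_exp (by positivity)
  · refine (hM a ha).trans ?_
    -- Away from `0`, the exponent can be raised by `β` at the cost of a constant.
    have h1 : 1 ≤ (δ ^ β)⁻¹ * ‖a‖ ^ β := by
      rw [inv_mul_eq_div, one_le_div (by positivity)]
      gcongr
    calc M * (‖a‖ ^ (τ - 1) * Real.exp (Λ * ‖a‖))
        = M * (‖a‖ ^ (τ - 1) * Real.exp (Λ * ‖a‖)) * 1 := (mul_one _).symm
      _ ≤ M * (‖a‖ ^ (τ - 1) * Real.exp (Λ * ‖a‖)) * ((δ ^ β)⁻¹ * ‖a‖ ^ β) := by gcongr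
      _ = (0 + M * (δ ^ β)⁻¹) * (‖a‖ ^ (τ - 1 + β) * Real.exp (Λ * ‖a‖)) := by
        rw [Real.rpow_add hpos]; ring
      _ ≤ _ := by
        gcongr
        positivity

/-! ### Fixed points of eventual contractions -/

/-- The operator `T` multiplies the norm of each `SingExp Ω σ Λ` with `Λ` large by at most `θ`. -/
def EventuallyNormLE (Ω : Set ℂ) (T : (ℂ → ℂ) → ℂ → ℂ) (σ θ : ℝ) : Prop :=
  ∀ᶠ Λ in atTop, ∀ (f : ℂ → ℂ) (M : ℝ), 0 ≤ M →
    (∀ z ∈ Ω, ‖f z‖ ≤ M * (‖z‖ ^ σ * Real.exp (Λ * ‖z‖))) →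
    ∀ a ∈ Ω, ‖T f a‖ ≤ θ * M * (‖a‖ ^ σ * Real.exp (Λ * ‖a‖))

/-- An eventual contraction has no nonzero fixed point. -/
theorem EventuallyNormLE.eqOn_zero {T : (ℂ → ℂ) → ℂ → ℂ} (hT : EventuallyNormLE Ω T σ θ)
    (hθ0 : 0 ≤ θ) (hθ1 : θ < 1) (hf : f ∈ SingExpUnion Ω σ) (hfix : ∀ a ∈ Ω, f a = T f a) :
    ∀ a ∈ Ω, f a = 0 := by
  obtain ⟨-, M, hM0, hM⟩ := mem_singExpUnion_iff.1 hf
  -- One `Λ` must serve both for the contraction and for the bound on `f`, hence bounds valid for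
  -- all large `Λ`.
  obtain ⟨Λ, hM, hΛ⟩ := (hM.and hT).exists
  have key : ∀ n : ℕ, ∀ z ∈ Ω, ‖f z‖ ≤ θ ^ n * M * (‖z‖ ^ σ * Real.exp (Λ * ‖z‖)) := by
    intro n
    induction n with
    | zero => simpa using hM
    | succ n ih =>
      intro z hz
      rw [hfix z hz, pow_succ']
      simpa only [mul_assoc] using hΛ f _ (by positivity) ih z hz
  intro a ha
  have hlim : Tendsto (fun n : ℕ => θ ^ n * M * (‖a‖ ^ σ * Real.exp (Λ * ‖a‖))) atTop (𝓝 0) := by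
    simpa using ((tendsto_pow_atTop_nhds_zero_of_lt_one hθ0 hθ1).mul_const M).mul_const
      (‖a‖ ^ σ * Real.exp (Λ * ‖a‖))
  exact norm_le_zero_iff.1 (ge_of_tendsto' hlim fun n => key n a ha)

/-- Picard iteration for an eventual contraction on `SingExpUnion Ω σ`. -/
theorem EventuallyNormLE.exists_fixedPoint {T : (ℂ → ℂ) → ℂ → ℂ} (hΩ : IsDomain Ω)
    (hT : EventuallyNormLE Ω T σ θ) (hθ0 : 0 ≤ θ) (hθ1 : θ < 1)
    (hmaps : ∀ f ∈ SingExpUnion Ω σ, T f ∈ SingExpUnion Ω σ)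
    (hsub : ∀ f ∈ SingExpUnion Ω σ, ∀ g ∈ SingExpUnion Ω σ, ∀ a ∈ Ω,
      T (fun z => f z - g z) a = T f a - T g a) {h : ℂ → ℂ} (hh : h ∈ SingExpUnion Ω σ) :
    ∃ g ∈ SingExpUnion Ω σ, ∀ a ∈ Ω, g a = T g a + h a := by
  have hTh : (fun z => T h z + h z) ∈ SingExpUnion Ω σ := singExpUnion_add (hmaps h hh) hh
  obtain ⟨-, M₀, hM₀, hb₀⟩ := mem_singExpUnion_iff.1 hh
  obtain ⟨-, M, hM0, hb⟩ := mem_singExpUnion_iff.1 (singExpUnion_sub hTh hh)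
  obtain ⟨Λ, hΛ, hb₀, hb⟩ := (hT.and (hb₀.and hb)).exists
  set W : ℂ → ℝ := fun z => ‖z‖ ^ σ * Real.exp (Λ * ‖z‖) with hW
  have hW0 : ∀ z, 0 ≤ W z := fun z => by positivity
  let u : ℕ → ℂ → ℂ := fun n => Nat.rec h (fun _ v z => T v z + h z) n
  have hu0 : u 0 = h := rfl
  have hus : ∀ n, u (n + 1) = fun z => T (u n) z + h z := fun n => rfl
  have hu : ∀ n, u n ∈ SingExpUnion Ω σ := by
    intro n
    induction n with
    | zero => exact hh
    | succ n ih => exact singExpUnion_add (hmaps _ ih) hh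
  have hstep : ∀ n, ∀ z ∈ Ω, ‖u (n + 1) z - u n z‖ ≤ θ ^ n * M * W z := by
    intro n
    induction n with
    | zero => simpa [hus, hu0] using hb
    | succ n ih =>
      intro z hz
      have h1 := hΛ (fun z => u (n + 1) z - u n z) (θ ^ n * M) (by positivity) ih z hz
      rw [hsub _ (hu (n + 1)) _ (hu n) z hz] at h1
      have h2 : u (n + 1 + 1) z - u (n + 1) z = T (u (n + 1)) z - T (u n) z := by
        rw [hus (n + 1)]
        nth_rewrite 2 [hus n]
        ring
      rw [h2, pow_succ']
      simpa only [mul_assoc] using h1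
  have hdist : ∀ z ∈ Ω, ∀ n, dist (u n z) (u (n + 1) z) ≤ M * W z * θ ^ n := by
    intro z hz n
    rw [dist_comm, dist_eq_norm]
    exact (hstep n z hz).trans (le_of_eq (by ring))
  -- Nothing is asked of the limit off `Ω`.
  have hlim : ∀ z : ℂ, ∃ y, z ∈ Ω → Tendsto (fun n => u n z) atTop (𝓝 y) := by
    intro z
    by_cases hz : z ∈ Ω
    · obtain ⟨y, hy⟩ := cauchySeq_tendsto_of_complete
        (cauchySeq_of_le_geometric θ _ hθ1 (hdist z hz))
      exact ⟨y, fun _ => hy⟩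
    · exact ⟨0, fun h => absurd h hz⟩
  choose g hg using hlim
  have herr : ∀ n, ∀ z ∈ Ω, ‖u n z - g z‖ ≤ θ ^ n * (M / (1 - θ)) * W z := by
    intro n z hz
    rw [← dist_eq_norm]
    exact (dist_le_of_le_geometric_of_tendsto θ _ hθ1 (hdist z hz) (hg z hz) n).trans
      (le_of_eq (by ring))
  have hN : 0 ≤ M / (1 - θ) := div_nonneg hM0 (by linarith)
  have hpow := tendsto_pow_atTop_nhds_zero_of_lt_one hθ0 hθ1
  have hloc : TendstoLocallyUniformlyOn u g atTop Ω := by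
    rw [tendstoLocallyUniformlyOn_iff_forall_isCompact hΩ.isOpen]
    intro K hKΩ hK
    have hcont : ContinuousOn W K :=
      (continuous_norm.continuousOn.rpow_const fun z hz => Or.inl (hΩ.norm_pos (hKΩ hz)).ne').mul
        (by fun_prop)
    obtain ⟨G, hG⟩ := hK.bddAbove_image hcont
    rw [Metric.tendstoUniformlyOn_iff]
    intro r hr
    have h1 : Tendsto (fun n : ℕ => θ ^ n * (M / (1 - θ)) * G) atTop (𝓝 0) := by
      simpa using (hpow.mul_const (M / (1 - θ))).mul_const G
    filter_upwards [h1.eventually_lt_const hr] with n hn z hz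
    rw [dist_comm, dist_eq_norm]
    refine (herr n z (hKΩ hz)).trans_lt (lt_of_le_of_lt ?_ hn)
    gcongr
    exact hG (mem_image_of_mem _ hz)
  have hgmem : g ∈ SingExpUnion Ω σ := by
    refine mem_iUnion.2 ⟨Λ, hloc.differentiableOn
      (Eventually.of_forall fun n => (mem_singExpUnion_iff.1 (hu n)).1) hΩ.isOpen,
      M₀ + M / (1 - θ), fun z hz => ?_⟩
    have h1 := herr 0 z hz
    have h2 := norm_sub_le (u 0 z) (u 0 z - g z)
    rw [sub_sub_cancel] at h2
    rw [pow_zero, one_mul] at h1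
    have h3 := hb₀ z hz
    rw [hu0] at h1 h2
    rw [add_mul]
    linarith
  refine ⟨g, hgmem, fun a ha => ?_⟩
  -- The contraction bound applied to `u n - g` supplies the continuity of `T` needed to pass to the
  -- limit in the recursion.
  have hTlim : Tendsto (fun n => T (u n) a) atTop (𝓝 (T g a)) := by
    rw [tendsto_iff_norm_sub_tendsto_zero]
    have h1 : Tendsto (fun n : ℕ => θ * (θ ^ n * (M / (1 - θ))) * W a) atTop (𝓝 0) := by
      simpa using ((hpow.mul_const (M / (1 - θ))).const_mul θ).mul_const (W a)
    refine squeeze_zero (fun n => norm_nonneg _) (fun n => ?_) h1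
    rw [← hsub _ (hu n) _ hgmem a ha]
    exact hΛ _ _ (by positivity) (herr n) a ha
  exact tendsto_nhds_unique ((tendsto_add_atTop_iff_nat 1).2 (hg a ha))
    (hTlim.add_const (h a))

end SingVolterra

/-! ### Reduction to the contraction and conclusion -/

open SingVolterra in
theorem proposition3p9
    (Ω : Set ℂ) (hΩ : SingVolterra.IsDomain Ω)
    (p q : ℂ → ℂ) (hp : DifferentiableOn ℂ p Ω) (hq : DifferentiableOn ℂ q Ω)
    (hp0 : ∀ a ∈ Ω, p a ≠ 0)
    (kstar : ℂ → ℂ → ℂ) (hkstar : SingVolterra.IsHolomorphicKernel Ω kstar)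
    (τ γ lam ε : ℝ) (B : ℂ)
    (hsing : SingVolterra.CondSing Ω (SingVolterra.sepKernel p q) τ)
    (hdiag : SingVolterra.CondDiag Ω (SingVolterra.sepKernel p q) lam)
    (hstar : SingVolterra.CondDiagStar Ω kstar γ lam)
    (hreg : SingVolterra.CondRegP Ω p B ε)
    (L : ℂ → ℂ) (hL : SingVolterra.IsLogBranch Ω L)
    (ρ : ℝ) (hρ : ρ ∈ Ioc τ (τ + min γ (min ε 1))) :
    -- the affine space lies in the space with exponent `τ - 1`, where both integrals converge
    SingVolterra.affineSingExp Ω (SingVolterra.branchPow L (τ - 1)) (ρ - 1) ⊆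
        SingVolterra.SingExpUnion Ω (τ - 1) ∧
    (∀ φ ∈ SingVolterra.SingExpUnion Ω (τ - 1), ∀ a ∈ Ω,
        SingVolterra.VolterraConverges (SingVolterra.sepKernel p q) φ a ∧
        SingVolterra.VolterraConverges kstar φ a) ∧
    -- existence and uniqueness, as functions on `Ω`
    ∃ f ∈ SingVolterra.affineSingExp Ω (SingVolterra.branchPow L (τ - 1)) (ρ - 1),
      (∀ a ∈ Ω, f a = SingVolterra.volterra (SingVolterra.sepKernel p q) f a +
          SingVolterra.volterra kstar f a) ∧
      ∀ g ∈ SingVolterra.affineSingExp Ω (SingVolterra.branchPow L (τ - 1)) (ρ - 1),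
        (∀ a ∈ Ω, g a = SingVolterra.volterra (SingVolterra.sepKernel p q) g a +
          SingVolterra.volterra kstar g a) →
        EqOn g f Ω := by
  obtain ⟨hτρ, hρle⟩ := hρ
  have hτ := hsing.pos
  have hτ' : -1 < τ - 1 := by linarith
  have hγρ : ρ ≤ τ + γ := hρle.trans (by gcongr; exact min_le_left _ _)
  have hερ : ρ ≤ τ + ε :=
    hρle.trans (by gcongr; exact (min_le_right _ _).trans (min_le_left _ _))
  have h1ρ : ρ ≤ τ + 1 :=
    hρle.trans (by gcongr; exact (min_le_right _ _).trans (min_le_right _ _))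
  have hker := isHolomorphicKernel_sepKernel hp hq hp0
  have hφ : branchPow L (τ - 1) ∈ SingExpUnion Ω (τ - 1) := hL.branchPow_mem
  have hincl : SingExpUnion Ω (ρ - 1) ⊆ SingExpUnion Ω (τ - 1) :=
    singExpUnion_subset hΩ (by linarith)
  have haff : affineSingExp Ω (branchPow L (τ - 1)) (ρ - 1) ⊆ SingExpUnion Ω (τ - 1) := by
    intro f hf
    simpa using singExpUnion_add (hincl hf) hφ
  have hconv : ∀ φ ∈ SingExpUnion Ω (τ - 1), ∀ a ∈ Ω,
      VolterraConverges (sepKernel p q) φ a ∧ VolterraConverges kstar φ a := fun φ hφ a ha =>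
    ⟨hdiag.volterraConverges hΩ hker hτ' hφ ha,
      hstar.condDiag.volterraConverges hΩ hkstar hτ' hφ ha⟩
  refine ⟨haff, hconv, ?_⟩
  let T : (ℂ → ℂ) → ℂ → ℂ := fun f a => volterra (sepKernel p q) f a + volterra kstar f a
  have hsub : ∀ f ∈ SingExpUnion Ω (τ - 1), ∀ g ∈ SingExpUnion Ω (τ - 1), ∀ a ∈ Ω,
      T (fun z => f z - g z) a = T f a - T g a := by
    intro f hf g hg a ha
    simp only [T]
    rw [volterra_sub (hconv f hf a ha).1 (hconv g hg a ha).1,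
      volterra_sub (hconv f hf a ha).2 (hconv g hg a ha).2]
    ring
  have hmaps : ∀ f ∈ SingExpUnion Ω (ρ - 1), T f ∈ SingExpUnion Ω (ρ - 1) := fun f hf =>
    singExpUnion_add (hdiag.volterra_mem hΩ hker (by linarith) hf)
      (hstar.condDiag.volterra_mem hΩ hkstar (by linarith) hf)
  obtain ⟨θ, hθ0, hθ1, hT⟩ : ∃ θ, 0 ≤ θ ∧ θ < 1 ∧ EventuallyNormLE Ω T (ρ - 1) θ := by
    -- With `τ < σ < ρ` and `σ / ρ < θ < 1`, the separable part uses up `σ / ρ` and leaves the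
    -- positive margin `θ - σ / ρ` to `kstar`.
    obtain ⟨σ, hσ1, hσ2⟩ := exists_between hτρ
    have hσ : 0 < σ := hτ.trans hσ1
    have hρ0 : 0 < ρ := hσ.trans hσ2
    obtain ⟨θ, hθ1, hθ2⟩ := exists_between ((div_lt_one hρ0).2 hσ2)
    refine ⟨θ, (div_pos hσ hρ0).le.trans hθ1.le, hθ2, ?_⟩
    filter_upwards [hdiag.eventually_norm_volterra_le hΩ hσ hρ0 (hsing.near σ hσ1) le_rfl,
      hstar.eventually_norm_volterra_le hΩ hρ0 (sub_pos.2 hθ1)] with Λ h1 h2 f M hM hf a ha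
    refine (norm_add_le _ _).trans ((add_le_add (h1 f M hM hf a ha) (h2 f M hM hf a ha)).trans
      (le_of_eq ?_))
    ring
  have hsource : (fun a => T (branchPow L (τ - 1)) a - branchPow L (τ - 1) a) ∈
      SingExpUnion Ω (ρ - 1) := by
    -- Here `β = ρ - τ`; the range of `ρ` ensures `β ≤ ε` and `β ≤ 1`, and `β ≤ γ` for the term from
    -- `kstar`.
    have h1 := volterra_sepKernel_branchPow_sub_mem hΩ hp hq hp0 hsing hdiag hreg hL
      (sub_pos.2 hτρ) (by linarith) (by linarith)
    have h2 := singExpUnion_subset hΩ (show ρ - 1 ≤ τ - 1 + γ by linarith)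
      (hstar.volterra_mem hΩ hkstar hτ' hφ)
    rw [show τ - 1 + (ρ - τ) = ρ - 1 by ring] at h1
    convert singExpUnion_add h1 h2 using 2
    simp only [T]
    ring
  obtain ⟨g, hg, hgT⟩ := hT.exists_fixedPoint hΩ hθ0 hθ1 hmaps
    (fun f hf g hg => hsub f (hincl hf) g (hincl hg)) hsource
  have hf : (fun z => branchPow L (τ - 1) z + g z) ∈
      affineSingExp Ω (branchPow L (τ - 1)) (ρ - 1) := by
    simpa [affineSingExp] using hg
  have hfix : ∀ a ∈ Ω, branchPow L (τ - 1) a + g a =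
      T (fun z => branchPow L (τ - 1) z + g z) a := by
    intro a ha
    have h1 := hsub _ (haff hf) _ hφ a ha
    simp only [add_sub_cancel_left] at h1
    rw [hgT a ha, h1]
    ring
  refine ⟨_, hf, hfix, fun f' hf' hfix' a ha => ?_⟩
  -- The leading powers cancel, so the difference lies in the smaller space where `T` contracts.
  have hd := singExpUnion_sub hf' hf
  simp only [sub_sub_sub_cancel_right] at hd
  refine sub_eq_zero.1 (hT.eqOn_zero hθ0 hθ1 hd (fun z hz => ?_) a ha)
  rw [hsub _ (haff hf') _ (haff hf) z hz]
  exact congrArg₂ _ (hfix' z hz) (hfix z hz)
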